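/- Let $E/\mathbb{Q}$ be an elliptic curve, given by a minimal Weierstrass equation $W$ over $\mathbb{Z}$ (an integral equation for $E$ whose discriminant has the smallest possible absolute value), and let $L(E/\mathbb{Q},s)=\sum_{m\ge 1} a_m m^{-s}$ be its $L$-series. The curve $E$ has good reduction at a prime $p$ if $W$ modulo $p$ is nonsingular. If $E$ has good reduction at every prime dividing a positive integer $m$, then $W$ defines an elliptic curve (a group scheme) over $\mathbb{Z}/m\mathbb{Z}$, and $E(\mathbb{Z}/m\mathbb{Z})$ denotes its group of $\mathbb{Z}/m\mathbb{Z}$-valued points. The exponent of a finite group is the least common multiple of the orders of its elements. Let $n$ be a positive integer. - $n$ is an *elliptic Carmichael number for $E$* if $n$ has at least two distinct prime factors, $E$ has good reduction at every prime dividing $n$, and $(n+1-a_n)P=0$ for every $P\in E(\mathbb{Z}/n\mathbb{Z})$. - $n$ is an *elliptic Korselt number for $E$ of Type II* if $n$ has at least two distinct prime factors and, for every prime $p$ dividing $n$, $E$ has good reduction at $p$ and the exponent of the group $E(\mathbb{Z}/p^{\operatorname{ord}_p(n)}\mathbb{Z})$ divides $n+1-a_n$. **Proposition (Elliptic Korselt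 Criterion II).** Let $n>2$ be an odd integer and let $E/\mathbb{Q}$ be an elliptic curve. Then $n$ is an elliptic Carmichael number for $E$ if and only if $n$ is an elliptic Korselt number for $E$ of Type II. -/

import Mathlib

namespace EllKorselt

open WeierstrassCurve WeierstrassCurve.Projective

universe u

/-! ### A second addition law

Mathlib's `addXYZ` computes `P + Q` except where `P = Q`.  The next three forms, again of bidegree
`(2, 2)` in `P` and `Q`, also represent `P + Q`, and do not all vanish where `P = Q`. -/

/-- The `X`-coordinate of the second addition law. -/
def altX {R : Type u} [CommRing R] (W : WeierstrassCurve R) (P Q : Fin 3 → R) : R :=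
  -W.a₃ * W.b₈ * P 2 ^ 2 * Q 2 ^ 2 - W.b₈ * P 2 ^ 2 * Q 1 * Q 2
    - W.a₃ * (W.a₃ ^ 2 + 6 * W.a₆) * P 2 ^ 2 * Q 0 * Q 2
    - 3 * W.a₆ * P 2 ^ 2 * Q 0 * Q 1 - W.a₃ * W.a₄ * P 2 ^ 2 * Q 0 ^ 2
    - W.b₈ * P 1 * P 2 * Q 2 ^ 2 - 6 * W.a₆ * P 1 * P 2 * Q 0 * Q 2
    + 2 * W.a₃ * P 1 * P 2 * Q 0 * Q 1 + (W.a₁ * W.a₃ - W.a₄) * P 1 * P 2 * Q 0 ^ 2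
    + W.a₃ * P 1 ^ 2 * Q 0 * Q 2 + P 1 ^ 2 * Q 0 * Q 1 + W.a₁ * P 1 ^ 2 * Q 0 ^ 2
    - (W.a₁ * W.b₈ + W.a₃ ^ 3 + 3 * W.a₃ * W.a₆) * P 0 * P 2 * Q 2 ^ 2
    - (2 * W.a₃ ^ 2 + 6 * W.a₆) * P 0 * P 2 * Q 1 * Q 2
    - (2 * W.a₁ * W.a₃ ^ 2 + 2 * W.a₃ * W.a₄ + 6 * W.a₁ * W.a₆) * P 0 * P 2 * Q 0 * Q 2
    - 2 * W.a₄ * P 0 * P 2 * Q 0 * Q 1 - (W.a₂ * W.a₃ + W.a₁ * W.a₄) * P 0 * P 2 * Q 0 ^ 2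
    - (W.a₃ ^ 2 + 3 * W.a₆) * P 0 * P 1 * Q 2 ^ 2 + P 0 * P 1 * Q 1 ^ 2
    - 2 * W.a₄ * P 0 * P 1 * Q 0 * Q 2 + 2 * W.a₁ * P 0 * P 1 * Q 0 * Q 1
    + (W.a₁ ^ 2 - W.a₂) * P 0 * P 1 * Q 0 ^ 2
    - W.a₁ * (W.a₃ ^ 2 + 3 * W.a₆) * P 0 ^ 2 * Q 2 ^ 2
    - (W.a₁ * W.a₃ + W.a₄) * P 0 ^ 2 * Q 1 * Q 2
    - (W.a₁ ^ 2 * W.a₃ + 2 * W.a₁ * W.a₄) * P 0 ^ 2 * Q 0 * Q 2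
    - W.a₂ * P 0 ^ 2 * Q 0 * Q 1 - W.a₁ * W.a₂ * P 0 ^ 2 * Q 0 ^ 2

/-- The `Y`-coordinate of the second addition law. -/
def altY {R : Type u} [CommRing R] (W : WeierstrassCurve R) (P Q : Fin 3 → R) : R :=
  ((W.a₁ * W.a₃ + W.a₄) * W.b₈ - (W.a₃ ^ 2 + 3 * W.a₆) ^ 2) * P 2 ^ 2 * Q 2 ^ 2
    + (W.a₂ * W.b₈ - 2 * W.a₃ ^ 2 * W.a₄ + 3 * W.a₁ * W.a₃ * W.a₆ - 3 * W.a₄ * W.a₆)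
      * P 2 ^ 2 * Q 0 * Q 2
    + (3 * W.a₂ * W.a₆ - W.a₄ ^ 2) * P 2 ^ 2 * Q 0 ^ 2
    + (W.a₁ * W.b₈ - W.a₃ ^ 3 - 3 * W.a₃ * W.a₆) * P 1 * P 2 * Q 2 ^ 2
    + (6 * W.a₁ * W.a₆ - 2 * W.a₃ * W.a₄) * P 1 * P 2 * Q 0 * Q 2
    + (W.a₁ * W.a₄ - W.a₂ * W.a₃) * P 1 * P 2 * Q 0 ^ 2
    + W.a₃ * P 1 ^ 2 * Q 1 * Q 2 + P 1 ^ 2 * Q 1 ^ 2 + W.a₁ * P 1 ^ 2 * Q 0 * Q 1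
    + ((W.a₁ ^ 2 + W.a₂) * W.b₈ - (W.a₁ * W.a₃ + W.a₄) * (W.a₃ ^ 2 + 3 * W.a₆))
      * P 0 * P 2 * Q 2 ^ 2
    + (2 * W.a₂ * W.a₃ ^ 2 - 4 * W.a₁ * W.a₃ * W.a₄ - 4 * W.a₄ ^ 2 + 6 * W.a₁ ^ 2 * W.a₆
      + 12 * W.a₂ * W.a₆) * P 0 * P 2 * Q 0 * Q 2
    + (9 * W.a₆ - W.a₂ * W.a₄) * P 0 * P 2 * Q 0 ^ 2
    + (3 * W.a₁ * W.a₆ - W.a₃ * W.a₄) * P 0 * P 1 * Q 2 ^ 2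
    + 2 * (W.a₁ * W.a₄ - W.a₂ * W.a₃) * P 0 * P 1 * Q 0 * Q 2
    + (W.a₁ * W.a₂ - 3 * W.a₃) * P 0 * P 1 * Q 0 ^ 2
    + (W.a₂ * W.a₃ ^ 2 - 2 * W.a₁ * W.a₃ * W.a₄ - W.a₄ ^ 2 + 3 * W.a₁ ^ 2 * W.a₆
      + 3 * W.a₂ * W.a₆) * P 0 ^ 2 * Q 2 ^ 2
    + (3 * W.a₃ ^ 2 - 2 * W.a₁ * W.a₂ * W.a₃ + W.a₁ ^ 2 * W.a₄ - W.a₂ * W.a₄ + 9 * W.a₆)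
      * P 0 ^ 2 * Q 0 * Q 2
    + (3 * W.a₄ - W.a₂ ^ 2) * P 0 ^ 2 * Q 0 ^ 2

/-- The `Z`-coordinate of the second addition law. -/
def altZ {R : Type u} [CommRing R] (W : WeierstrassCurve R) (P Q : Fin 3 → R) : R :=
  -W.toProjective.addY P (W.toProjective.neg Q)

/-- The second addition law. -/
def altXYZ {R : Type u} [CommRing R] (W : WeierstrassCurve R) (P Q : Fin 3 → R) : Fin 3 → R :=
  ![altX W P Q, altY W P Q, altZ W P Q]

/-- Two vectors are parallel if all `2 × 2` minors of the matrix that they form vanish. -/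
def Parallel {R : Type u} [CommRing R] (v w : Fin 3 → R) : Prop :=
  ∀ i j, v i * w j = v j * w i

theorem parallel_iff {R : Type u} [CommRing R] {v w : Fin 3 → R} : Parallel v w ↔
    v 0 * w 1 = v 1 * w 0 ∧ v 0 * w 2 = v 2 * w 0 ∧ v 1 * w 2 = v 2 * w 1 := by
  refine ⟨fun h => ⟨h 0 1, h 0 2, h 1 2⟩, fun ⟨h₁, h₂, h₃⟩ i j => ?_⟩
  fin_cases i <;> fin_cases j <;>
    first | rfl | assumption | (symm; assumption)

theorem Parallel.smul {R : Type u} [CommRing R] {v w : Fin 3 → R} (h : Parallel v w) (a b : R) :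
    Parallel (a • v) (b • w) := by
  intro i j
  simp only [Pi.smul_apply, smul_eq_mul]
  linear_combination a * b * h i j

theorem Parallel.symm {R : Type u} [CommRing R] {v w : Fin 3 → R} (h : Parallel v w) :
    Parallel w v := fun i j => by linear_combination h j i

theorem parallel_refl {R : Type u} [CommRing R] (v : Fin 3 → R) : Parallel v v :=
  fun _ _ => mul_comm _ _

theorem Parallel.map {R S : Type*} [CommRing R] [CommRing S] (f : R →+* S) {v w : Fin 3 → R}
    (h : Parallel v w) : Parallel (f ∘ v) (f ∘ w) := fun i j => by
  simp only [Function.comp_apply, ← map_mul, h i j]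

theorem altXYZ_smul {R : Type u} [CommRing R] (W : WeierstrassCurve R) (P Q : Fin 3 → R) (a b : R) :
    altXYZ W (a • P) (b • Q) = (a * b) ^ 2 • altXYZ W P Q := by
  ext i
  fin_cases i
  · simp [altXYZ, altX]; ring
  · simp [altXYZ, altY]; ring
  · simp only [altXYZ, altZ, Projective.neg_smul, addY_smul, Pi.smul_apply, smul_eq_mul]
    simp

theorem altXYZ_map {R S : Type*} [CommRing R] [CommRing S] (f : R →+* S) (W : WeierstrassCurve R)
    (P Q : Fin 3 → R) : altXYZ (W.map f) (f ∘ P) (f ∘ Q) = f ∘ altXYZ W P Q := by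
  ext i
  fin_cases i
  · simp [altXYZ, altX, map_ofNat]
  · simp [altXYZ, altY, map_ofNat]
  · simp [altXYZ, altZ, Projective.map_neg, map_addY]

section Field

variable {F : Type u} [Field F] (W : WeierstrassCurve F)

theorem altX_cross {x₁ y₁ x₂ y₂ : F} (h₁ : W.toProjective.Equation ![x₁, y₁, 1])
    (h₂ : W.toProjective.Equation ![x₂, y₂, 1]) (hx : x₁ - x₂ ≠ 0) :
    altX W ![x₁, y₁, 1] ![x₂, y₂, 1] * (x₁ - x₂) ^ 2 =
      ((y₁ - y₂) ^ 2 + W.a₁ * (y₁ - y₂) * (x₁ - x₂) - (W.a₂ + x₁ + x₂) * (x₁ - x₂) ^ 2) *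
        altZ W ![x₁, y₁, 1] ![x₂, y₂, 1] := by
  rw [equation_iff] at h₁ h₂
  obtain ⟨a₁, a₂, a₃, a₄, a₆⟩ := W
  simp only [fin3_def_ext] at h₁ h₂
  have h6 : a₆ = y₁ ^ 2 + a₁ * x₁ * y₁ + a₃ * y₁ - x₁ ^ 3 - a₂ * x₁ ^ 2 - a₄ * x₁ := by
    linear_combination -h₁
  have h4 : a₄ = ((y₁ ^ 2 + a₁ * x₁ * y₁ + a₃ * y₁ - x₁ ^ 3 - a₂ * x₁ ^ 2) -
      (y₂ ^ 2 + a₁ * x₂ * y₂ + a₃ * y₂ - x₂ ^ 3 - a₂ * x₂ ^ 2)) / (x₁ - x₂) := by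
    rw [eq_div_iff hx]; linear_combination h₂ - h₁
  clear h₁ h₂
  simp only [altX, altZ, addY, addX, negAddY, addZ, neg, negY, fin3_def_ext, b₈]
  subst h6
  subst h4
  field_simp
  ring

theorem altY_cross {x₁ y₁ x₂ y₂ : F} (h₁ : W.toProjective.Equation ![x₁, y₁, 1])
    (h₂ : W.toProjective.Equation ![x₂, y₂, 1]) (hx : x₁ - x₂ ≠ 0) :
    altY W ![x₁, y₁, 1] ![x₂, y₂, 1] * (x₁ - x₂) ^ 3 =
      (-((y₁ - y₂) * ((y₁ - y₂) ^ 2 + W.a₁ * (y₁ - y₂) * (x₁ - x₂)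
          - (W.a₂ + x₁ + x₂) * (x₁ - x₂) ^ 2 - x₁ * (x₁ - x₂) ^ 2) + y₁ * (x₁ - x₂) ^ 3)
        - W.a₁ * ((y₁ - y₂) ^ 2 + W.a₁ * (y₁ - y₂) * (x₁ - x₂)
          - (W.a₂ + x₁ + x₂) * (x₁ - x₂) ^ 2) * (x₁ - x₂) - W.a₃ * (x₁ - x₂) ^ 3) *
        altZ W ![x₁, y₁, 1] ![x₂, y₂, 1] := by
  rw [equation_iff] at h₁ h₂
  obtain ⟨a₁, a₂, a₃, a₄, a₆⟩ := W
  simp only [fin3_def_ext] at h₁ h₂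
  have h6 : a₆ = y₁ ^ 2 + a₁ * x₁ * y₁ + a₃ * y₁ - x₁ ^ 3 - a₂ * x₁ ^ 2 - a₄ * x₁ := by
    linear_combination -h₁
  have h4 : a₄ = ((y₁ ^ 2 + a₁ * x₁ * y₁ + a₃ * y₁ - x₁ ^ 3 - a₂ * x₁ ^ 2) -
      (y₂ ^ 2 + a₁ * x₂ * y₂ + a₃ * y₂ - x₂ ^ 3 - a₂ * x₂ ^ 2)) / (x₁ - x₂) := by
    rw [eq_div_iff hx]; linear_combination h₂ - h₁
  clear h₁ h₂
  simp only [altY, altZ, addY, addX, negAddY, addZ, neg, negY, fin3_def_ext, b₈]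
  subst h6
  subst h4
  field_simp
  ring

theorem altXYZ_self_affine {x y : F} (h : W.toProjective.Equation ![x, y, 1]) :
    altXYZ W ![x, y, 1] ![x, y, 1] = W.toProjective.dblXYZ ![x, y, 1] := by
  rw [equation_iff] at h
  obtain ⟨a₁, a₂, a₃, a₄, a₆⟩ := W
  simp only [fin3_def_ext] at h
  have h6 : a₆ = y ^ 2 + a₁ * x * y + a₃ * y - x ^ 3 - a₂ * x ^ 2 - a₄ * x := by
    linear_combination -h
  clear h
  simp only [altXYZ, dblXYZ, altX, altY, altZ, addY, addX, negAddY, addZ, neg, negY, dblX, dblY,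
    negDblY, dblZ, fin3_def_ext, b₈]
  subst h6
  congr 1
  · ring
  congr 1
  · ring
  congr 1
  ring

theorem altX_neg_affine {x y : F} (h : W.toProjective.Equation ![x, y, 1]) :
    altX W ![x, y, 1] ![x, -y - W.a₁ * x - W.a₃, 1] = 0 := by
  rw [equation_iff] at h
  obtain ⟨a₁, a₂, a₃, a₄, a₆⟩ := W
  simp only [fin3_def_ext] at h
  have h6 : a₆ = y ^ 2 + a₁ * x * y + a₃ * y - x ^ 3 - a₂ * x ^ 2 - a₄ * x := by
    linear_combination -h
  clear h
  simp only [altX, fin3_def_ext, b₈]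
  subst h6
  ring

theorem altZ_neg_affine {x y : F} :
    altZ W ![x, y, 1] ![x, -y - W.a₁ * x - W.a₃, 1] = 0 := by
  simp only [altZ, addY, addX, negAddY, addZ, neg, negY, fin3_def_ext]
  ring

end Field

section Field

variable {F : Type u} [Field F] (W : WeierstrassCurve F)

theorem eq_smul_affine {P : Fin 3 → F} (hz : P 2 ≠ 0) : P = P 2 • ![P 0 / P 2, P 1 / P 2, 1] := by
  ext i
  fin_cases i <;> simp [mul_div_cancel₀, hz]

theorem equation_affine {P : Fin 3 → F} (hP : W.toProjective.Equation P) (hz : P 2 ≠ 0) :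
    W.toProjective.Equation ![P 0 / P 2, P 1 / P 2, 1] := by
  rw [eq_smul_affine hz] at hP
  exact (equation_smul _ hz.isUnit).mp hP

theorem altXYZ_self {P : Fin 3 → F} (hP : W.toProjective.Equation P) :
    altXYZ W P P = W.toProjective.dblXYZ P := by
  by_cases hz : P 2 = 0
  · have hx : P 0 = 0 := X_eq_zero_of_Z_eq_zero hP hz
    rw [dblXYZ_of_Z_eq_zero hP hz]
    ext i
    fin_cases i <;>
      simp [altXYZ, altX, altY, altZ, addY, addX, negAddY, addZ, neg, negY, hx, hz]
    ring
  · have h := altXYZ_self_affine W (equation_affine W hP hz)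
    rw [eq_smul_affine hz, altXYZ_smul, dblXYZ_smul, h]
    ring_nf

theorem parallel_altXYZ_affine {x₁ y₁ x₂ y₂ : F} (h₁ : W.toProjective.Equation ![x₁, y₁, 1])
    (h₂ : W.toProjective.Equation ![x₂, y₂, 1]) (hne : ¬ (x₁ = x₂ ∧ y₁ = y₂)) :
    Parallel (altXYZ W ![x₁, y₁, 1] ![x₂, y₂, 1])
      (W.toProjective.addXYZ ![x₁, y₁, 1] ![x₂, y₂, 1]) := by
  by_cases hx : x₁ = x₂
  · subst hx
    have hy : y₂ = -y₁ - W.a₁ * x₁ - W.a₃ := by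
      have hy' : y₁ - y₂ ≠ 0 := fun h => hne ⟨rfl, sub_eq_zero.mp h⟩
      rw [equation_iff] at h₁ h₂
      simp only [fin3_def_ext] at h₁ h₂
      apply mul_left_cancel₀ hy'
      linear_combination h₁ - h₂
    rw [addXYZ_of_X_eq h₁ h₂ (by simp) (by simp) (by simp), parallel_iff]
    have hX := altX_neg_affine W h₁
    have hZ := altZ_neg_affine W (x := x₁) (y := y₁)
    rw [← hy] at hX hZ
    simp [altXYZ, hX, hZ]
  · have hd : x₁ - x₂ ≠ 0 := sub_ne_zero.mpr hx
    have eX := altX_cross W h₁ h₂ hd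
    have eY := altY_cross W h₁ h₂ hd
    have fX := addX_eq' h₁ h₂
    have fY := negAddY_eq' h₁ h₂
    have fZ := addZ_eq' h₁ h₂
    simp only [fin3_def_ext, mul_one, one_pow] at fX fY fZ
    have gY : W.toProjective.addY ![x₁, y₁, 1] ![x₂, y₂, 1] =
        -W.toProjective.negAddY ![x₁, y₁, 1] ![x₂, y₂, 1]
          - W.a₁ * W.toProjective.addX ![x₁, y₁, 1] ![x₂, y₂, 1]
          - W.a₃ * W.toProjective.addZ ![x₁, y₁, 1] ![x₂, y₂, 1] := rfl
    have kX : altX W ![x₁, y₁, 1] ![x₂, y₂, 1] * W.toProjective.addZ ![x₁, y₁, 1] ![x₂, y₂, 1] =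
        altZ W ![x₁, y₁, 1] ![x₂, y₂, 1] * W.toProjective.addX ![x₁, y₁, 1] ![x₂, y₂, 1] := by
      rw [fX, fZ]
      linear_combination (x₁ - x₂) * eX
    have kY : altY W ![x₁, y₁, 1] ![x₂, y₂, 1] * W.toProjective.addZ ![x₁, y₁, 1] ![x₂, y₂, 1] =
        altZ W ![x₁, y₁, 1] ![x₂, y₂, 1] * W.toProjective.addY ![x₁, y₁, 1] ![x₂, y₂, 1] := by
      rw [gY, fX, fY, fZ]
      linear_combination eY
    refine parallel_iff.mpr ⟨?_, kX, kY⟩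
    have hZ : W.toProjective.addZ ![x₁, y₁, 1] ![x₂, y₂, 1] ≠ 0 := by
      rw [fZ]; exact pow_ne_zero 3 hd
    apply mul_left_cancel₀ hZ
    simp only [altXYZ, addXYZ, fin3_def_ext]
    linear_combination W.toProjective.addY ![x₁, y₁, 1] ![x₂, y₂, 1] * kX
      - W.toProjective.addX ![x₁, y₁, 1] ![x₂, y₂, 1] * kY

theorem parallel_altXYZ_addXYZ {P Q : Fin 3 → F} (hP : W.toProjective.Nonsingular P)
    (hQ : W.toProjective.Nonsingular Q) (h : ¬ P ≈ Q) :
    Parallel (altXYZ W P Q) (W.toProjective.addXYZ P Q) := by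
  by_cases hPz : P 2 = 0
  · have hx : P 0 = 0 := X_eq_zero_of_Z_eq_zero hP.1 hPz
    rw [addXYZ_of_Z_eq_zero_left hP.1 hPz]
    have : altXYZ W P Q = (P 1 ^ 2 * (Q 1 + W.a₁ * Q 0 + W.a₃ * Q 2)) • Q := by
      ext i
      fin_cases i <;>
        simp [altXYZ, altX, altY, altZ, addY, addX, negAddY, addZ, neg, negY, hx, hPz] <;> ring
    rw [this]
    exact (parallel_refl Q).smul _ _
  by_cases hQz : Q 2 = 0
  · have hx : Q 0 = 0 := X_eq_zero_of_Z_eq_zero hQ.1 hQz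
    rw [addXYZ_of_Z_eq_zero_right hQ.1 hQz]
    have : altXYZ W P Q = (Q 1 ^ 2 * P 1) • P := by
      ext i
      fin_cases i <;>
        simp [altXYZ, altX, altY, altZ, addY, addX, negAddY, addZ, neg, negY, hx, hQz] <;> ring
    rw [this]
    exact (parallel_refl P).smul _ _
  have hne : ¬ (P 0 / P 2 = Q 0 / Q 2 ∧ P 1 / P 2 = Q 1 / Q 2) := fun ⟨h₁, h₂⟩ =>
    h <| equiv_of_X_eq_of_Y_eq hPz hQz ((div_eq_div_iff hPz hQz).mp h₁)
      ((div_eq_div_iff hPz hQz).mp h₂)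
  have key := parallel_altXYZ_affine W (equation_affine W hP.1 hPz) (equation_affine W hQ.1 hQz) hne
  rw [eq_smul_affine hPz, eq_smul_affine hQz, altXYZ_smul, addXYZ_smul]
  exact key.smul _ _

/-- Over a field, both addition laws compute Mathlib's sum of two nonsingular points. -/
theorem parallel_add {P Q : Fin 3 → F} (hP : W.toProjective.Nonsingular P)
    (hQ : W.toProjective.Nonsingular Q) :
    Parallel (W.toProjective.addXYZ P Q) (W.toProjective.add P Q) ∧
      Parallel (altXYZ W P Q) (W.toProjective.add P Q) := by
  by_cases h : P ≈ Q
  · rw [add_of_equiv h]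
    obtain ⟨a, rfl⟩ := h
    have hQ' : altXYZ W ((a : F) • Q) ((1 : F) • Q) = ((a : F) * 1) ^ 2 • altXYZ W Q Q :=
      altXYZ_smul ..
    have hQ'' : W.toProjective.addXYZ ((a : F) • Q) ((1 : F) • Q) =
      ((a : F) * 1) ^ 2 • W.toProjective.addXYZ Q Q := addXYZ_smul ..
    rw [one_smul] at hQ' hQ''
    constructor
    · change Parallel (W.toProjective.addXYZ ((a : F) • Q) Q) _
      rw [hQ'', addXYZ_self]
      intro i j
      fin_cases i <;> fin_cases j <;> simp
    · change Parallel (altXYZ W ((a : F) • Q) Q) (W.toProjective.dblXYZ ((a : F) • Q))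
      rw [hQ', altXYZ_self W hQ.1, dblXYZ_smul]
      exact (parallel_refl _).smul _ _
  · rw [add_of_not_equiv h]
    exact ⟨parallel_refl _, parallel_altXYZ_addXYZ W hP hQ h⟩

theorem ne_zero_of_nonsingular {P : Fin 3 → F} (hP : W.toProjective.Nonsingular P) : P ≠ 0 := by
  rintro rfl
  simp [nonsingular_iff] at hP

/-- Over a field, the two addition laws do not vanish simultaneously. -/
theorem addXYZ_ne_zero_or {P Q : Fin 3 → F} (hP : W.toProjective.Nonsingular P)
    (hQ : W.toProjective.Nonsingular Q) :
    W.toProjective.addXYZ P Q ≠ 0 ∨ altXYZ W P Q ≠ 0 := by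
  have hS := ne_zero_of_nonsingular W (nonsingular_add hP hQ)
  by_cases h : P ≈ Q
  · right
    rw [add_of_equiv h] at hS
    obtain ⟨a, rfl⟩ := h
    have h' : altXYZ W ((a : F) • Q) ((1 : F) • Q) = ((a : F) * 1) ^ 2 • altXYZ W Q Q :=
      altXYZ_smul ..
    change W.toProjective.dblXYZ ((a : F) • Q) ≠ 0 at hS
    change altXYZ W ((a : F) • Q) Q ≠ 0
    rw [one_smul, altXYZ_self W hQ.1] at h'
    rw [dblXYZ_smul] at hS
    rw [h']
    exact smul_ne_zero (by simp) (right_ne_zero_of_smul hS)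
  · left
    rwa [add_of_not_equiv h] at hS

theorem nonsingular_of_ne_zero [W.IsElliptic] {P : Fin 3 → F} (hP : W.toProjective.Equation P)
    (h0 : P ≠ 0) : W.toProjective.Nonsingular P := by
  by_cases hz : P 2 = 0
  · rw [nonsingular_of_Z_eq_zero hz]
    have hx : P 0 = 0 := X_eq_zero_of_Z_eq_zero hP hz
    refine ⟨hP, Or.inr ?_⟩
    have hy : P 1 ≠ 0 := fun hy => h0 <| by ext i; fin_cases i <;> simp [hx, hy, hz]
    simpa [hx] using hy
  · rw [nonsingular_of_Z_ne_zero hz]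
    rw [equation_of_Z_ne_zero hz] at hP
    exact Affine.equation_iff_nonsingular.mp hP

end Field

/-! ### Points with values in a ring -/

/-- A vector is primitive if its entries generate the unit ideal. -/
def IsPrimitive {R : Type u} [CommRing R] (v : Fin 3 → R) : Prop :=
  ∃ c : Fin 3 → R, c 0 * v 0 + c 1 * v 1 + c 2 * v 2 = 1

/-- A vector of homogeneous coordinates of an `R`-valued point of the projective closure of `W`. -/
def IsCoord {R : Type u} [CommRing R] (W : WeierstrassCurve R) (v : Fin 3 → R) : Prop :=
  IsPrimitive v ∧ W.toProjective.Equation v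

/-- The points `[x : y : z]` with values in `R` of the projective closure of `W`: primitive
solutions of the homogeneous Weierstrass equation up to multiplication by units.  If every
invertible `R`-module is free, as for `R = ℤ/nℤ` with `n ≠ 0`, then these are all the sections over
`Spec R` of the plane cubic over `R` with this equation. -/
def RPoint {R : Type u} [CommRing R] (W : WeierstrassCurve R) : Type u :=
  {P : PointClass R // ∃ v, IsCoord W v ∧ ⟦v⟧ = P}

/-- The point with the homogeneous coordinates `v`. -/
def RPoint.mk {R : Type u} [CommRing R] {W : WeierstrassCurve R} (v : Fin 3 → R)
    (hv : IsCoord W v) : RPoint W := ⟨⟦v⟧, v, hv, rfl⟩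

/-- `s` represents the sum of the points represented by `v` and `w`: both addition laws,
applied to `v` and `w`, yield multiples of `s`. -/
def IsSumCoord {R : Type u} [CommRing R] (W : WeierstrassCurve R) (v w s : Fin 3 → R) : Prop :=
  Parallel (W.toProjective.addXYZ v w) s ∧ Parallel (altXYZ W v w) s

/-- The relation `P + Q = S` on points. -/
def IsSum {R : Type u} [CommRing R] {W : WeierstrassCurve R} (P Q S : RPoint W) : Prop :=
  ∃ v w s : Fin 3 → R, ⟦v⟧ = P.1 ∧ ⟦w⟧ = Q.1 ∧ ⟦s⟧ = S.1 ∧ IsSumCoord W v w s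

theorem isCoord_zero {R : Type u} [CommRing R] (W : WeierstrassCurve R) :
    IsCoord W ![0, 1, 0] := ⟨⟨![0, 1, 0], by simp⟩, equation_zero⟩

theorem IsCoord.neg {R : Type u} [CommRing R] {W : WeierstrassCurve R} {v : Fin 3 → R}
    (hv : IsCoord W v) : IsCoord W (W.toProjective.neg v) := by
  obtain ⟨⟨c, hc⟩, he⟩ := hv
  refine ⟨⟨![c 0 - W.a₁ * c 1, -c 1, c 2 - W.a₃ * c 1], ?_⟩, ?_⟩
  · simp only [Projective.neg, negY, fin3_def_ext]
    linear_combination hc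
  · rw [equation_iff] at he ⊢
    simp only [Projective.neg, negY, fin3_def_ext]
    linear_combination he

/-- The origin `[0 : 1 : 0]`. -/
instance {R : Type u} [CommRing R] (W : WeierstrassCurve R) : Zero (RPoint W) :=
  ⟨RPoint.mk ![0, 1, 0] (isCoord_zero W)⟩

/-- The negative `[x : -y - a₁ x - a₃ z : z]` of `[x : y : z]`. -/
instance {R : Type u} [CommRing R] (W : WeierstrassCurve R) : Neg (RPoint W) :=
  ⟨fun P => ⟨W.toProjective.negMap P.1, by
    obtain ⟨v, hv, h⟩ := P.2
    exact ⟨W.toProjective.neg v, hv.neg, by rw [← h]; rfl⟩⟩⟩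

open Classical in
/-- The sum of two points. -/
noncomputable instance {R : Type u} [CommRing R] (W : WeierstrassCurve R) : Add (RPoint W) :=
  ⟨fun P Q => if h : ∃ S, IsSum P Q S then h.choose else 0⟩

theorem IsPrimitive.map {R S : Type*} [CommRing R] [CommRing S] (f : R →+* S) {v : Fin 3 → R}
    (h : IsPrimitive v) : IsPrimitive (f ∘ v) := by
  obtain ⟨c, hc⟩ := h
  exact ⟨f ∘ c, by simp only [Function.comp_apply, ← map_mul, ← map_add, hc, map_one]⟩

theorem IsCoord.map {R S : Type*} [CommRing R] [CommRing S] (f : R →+* S) {W : WeierstrassCurve R}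
    {v : Fin 3 → R} (h : IsCoord W v) : IsCoord (W.map f) (f ∘ v) :=
  ⟨h.1.map f, h.2.map f⟩

theorem IsSumCoord.map {R S : Type*} [CommRing R] [CommRing S] (f : R →+* S)
    {W : WeierstrassCurve R} {v w s : Fin 3 → R} (h : IsSumCoord W v w s) :
    IsSumCoord (W.map f) (f ∘ v) (f ∘ w) (f ∘ s) := by
  refine ⟨?_, ?_⟩
  · have := h.1.map f
    rwa [← map_addXYZ] at this
  · have := h.2.map f
    rwa [← altXYZ_map] at this

theorem equiv_of_parallel {R : Type u} [CommRing R] {v w : Fin 3 → R} (hv : IsPrimitive v)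
    (hw : IsPrimitive w) (h : Parallel v w) : v ≈ w := by
  obtain ⟨c, hc⟩ := hv
  obtain ⟨d, hd⟩ := hw
  have hvw i : v i = (d 0 * v 0 + d 1 * v 1 + d 2 * v 2) * w i := by
    linear_combination -v i * hd + d 0 * h i 0 + d 1 * h i 1 + d 2 * h i 2
  have hab : (d 0 * v 0 + d 1 * v 1 + d 2 * v 2) * (c 0 * w 0 + c 1 * w 1 + c 2 * w 2) = 1 := by
    linear_combination hc - c 0 * hvw 0 - c 1 * hvw 1 - c 2 * hvw 2
  refine ⟨Units.mkOfMulEqOne _ _ hab, ?_⟩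
  ext i
  exact (hvw i).symm

theorem Parallel.of_equiv {R : Type u} [CommRing R] {v w v' w' : Fin 3 → R} (h : Parallel v w)
    (hv : v ≈ v') (hw : w ≈ w') : Parallel v' w' := by
  obtain ⟨a, rfl⟩ := Setoid.symm hv
  obtain ⟨b, rfl⟩ := Setoid.symm hw
  exact h.smul (a : R) (b : R)

theorem addXYZ_equiv {R : Type u} [CommRing R] (W : WeierstrassCurve R) {v w v' w' : Fin 3 → R}
    (hv : v ≈ v') (hw : w ≈ w') : W.toProjective.addXYZ v w ≈ W.toProjective.addXYZ v' w' := by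
  obtain ⟨a, rfl⟩ := hv
  obtain ⟨b, rfl⟩ := hw
  exact ⟨(a * b) ^ 2, (addXYZ_smul (W' := W) v' w' (a : R) (b : R)).symm⟩

theorem altXYZ_equiv {R : Type u} [CommRing R] (W : WeierstrassCurve R) {v w v' w' : Fin 3 → R}
    (hv : v ≈ v') (hw : w ≈ w') : altXYZ W v w ≈ altXYZ W v' w' := by
  obtain ⟨a, rfl⟩ := hv
  obtain ⟨b, rfl⟩ := hw
  exact ⟨(a * b) ^ 2, (altXYZ_smul W v' w' (a : R) (b : R)).symm⟩

theorem IsSumCoord.of_equiv {R : Type u} [CommRing R] {W : WeierstrassCurve R}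
    {v w s v' w' s' : Fin 3 → R} (h : IsSumCoord W v w s) (hv : v ≈ v') (hw : w ≈ w')
    (hs : s ≈ s') : IsSumCoord W v' w' s' :=
  ⟨h.1.of_equiv (addXYZ_equiv W hv hw) hs, h.2.of_equiv (altXYZ_equiv W hv hw) hs⟩

/-- On an elliptic curve, the two addition laws generate the unit ideal. -/
theorem span_laws {R : Type u} [CommRing R] (W : WeierstrassCurve R) [W.IsElliptic]
    {v w : Fin 3 → R} (hv : IsCoord W v) (hw : IsCoord W w) :
    Ideal.span (Set.range (W.toProjective.addXYZ v w) ∪ Set.range (altXYZ W v w)) = ⊤ := by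
  by_contra hI
  obtain ⟨m, hm, hle⟩ := Ideal.exists_le_maximal _ hI
  let := Ideal.Quotient.field m
  set f := Ideal.Quotient.mk m
  have hns {v : Fin 3 → R} (hv : IsCoord W v) : (W.map f).toProjective.Nonsingular (f ∘ v) := by
    refine nonsingular_of_ne_zero _ (hv.map f).2 fun h0 => ?_
    obtain ⟨c, hc⟩ := (hv.map f).1
    rw [h0] at hc
    simp at hc
  rw [Ideal.span_le] at hle
  rcases addXYZ_ne_zero_or _ (hns hv) (hns hw) with h | h
  · apply h
    rw [map_addXYZ]
    ext i
    exact Ideal.Quotient.eq_zero_iff_mem.mpr (hle (Or.inl ⟨i, rfl⟩))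
  · apply h
    rw [altXYZ_map]
    ext i
    exact Ideal.Quotient.eq_zero_iff_mem.mpr (hle (Or.inr ⟨i, rfl⟩))

theorem parallel_of_isSumCoord {R : Type u} [CommRing R] (W : WeierstrassCurve R) [W.IsElliptic]
    {v w s s' : Fin 3 → R} (hv : IsCoord W v) (hw : IsCoord W w) (h : IsSumCoord W v w s)
    (h' : IsSumCoord W v w s') : Parallel s s' := by
  intro i j
  rw [← sub_eq_zero]
  have key {L : Fin 3 → R} (hL : Parallel L s) (hL' : Parallel L s') (k : Fin 3) :
      L k * (s i * s' j - s j * s' i) = 0 := by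
    linear_combination s i * hL' k j - s j * hL' k i - s' k * hL i j
  have h1 : (1 : R) ∈ Ideal.span
      (Set.range (W.toProjective.addXYZ v w) ∪ Set.range (altXYZ W v w)) := by
    rw [span_laws W hv hw]; trivial
  rw [← one_mul (s i * s' j - s j * s' i)]
  refine Submodule.span_induction (p := fun x _ => x * (s i * s' j - s j * s' i) = 0)
    ?_ ?_ ?_ ?_ h1
  · rintro x (⟨k, rfl⟩ | ⟨k, rfl⟩)
    · exact key h.1 h'.1 k
    · exact key h.2 h'.2 k
  · simp
  · intro x y _ _ hx hy
    rw [add_mul, hx, hy, add_zero]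
  · intro a x _ hx
    rw [smul_eq_mul, mul_assoc, hx, mul_zero]

theorem mk_add_mk {R : Type u} [CommRing R] {W : WeierstrassCurve R} [W.IsElliptic]
    {v w s : Fin 3 → R} (hv : IsCoord W v) (hw : IsCoord W w) (hs : IsCoord W s)
    (h : IsSumCoord W v w s) : RPoint.mk v hv + RPoint.mk w hw = RPoint.mk s hs := by
  have hex : ∃ S, IsSum (RPoint.mk v hv) (RPoint.mk w hw) S :=
    ⟨RPoint.mk s hs, v, w, s, rfl, rfl, rfl, h⟩
  classical
  change (if h : ∃ S, IsSum (RPoint.mk v hv) (RPoint.mk w hw) S then h.choose else 0) = _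
  rw [dif_pos hex]
  obtain ⟨v', w', s', hv', hw', hs', h'⟩ := hex.choose_spec
  obtain ⟨t, ht, hst⟩ := hex.choose.2
  refine Subtype.ext (hst.symm.trans (Quotient.sound ?_))
  have hs't : s' ≈ t := Quotient.exact (hs'.trans hst.symm)
  exact equiv_of_parallel ht.1 hs.1 <| parallel_of_isSumCoord W hv hw
    (h'.of_equiv (Quotient.exact hv') (Quotient.exact hw') hs't) h

/-! ### The group law on points with values in `ℤ/nℤ` -/

theorem fact_prime_of_mem {n : ℕ} (p : n.primeFactors) : Fact (p : ℕ).Prime :=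
  ⟨Nat.prime_of_mem_primeFactors p.2⟩

section Lift

attribute [local instance] fact_prime_of_mem

variable {n : ℕ}

/-- The reduction map from the product of the `p`-adic integers over the primes `p ∣ n`. -/
noncomputable def padicToZMod (n : ℕ) [NeZero n] : (∀ p : n.primeFactors, ℤ_[p]) →+* ZMod n :=
  (ZMod.equivPi n (NeZero.ne n)).symm.toRingHom.comp
    (RingHom.pi fun p => (PadicInt.toZModPow (n.factorization p)).comp (Pi.evalRingHom _ p))

theorem padicToZMod_eq [NeZero n] {x : ∀ p : n.primeFactors, ℤ_[p]} {m : ℤ}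
    (h : ∀ p : n.primeFactors, PadicInt.toZModPow (n.factorization p) (x p) = m) :
    padicToZMod n x = m := by
  have : (RingHom.pi fun p : n.primeFactors =>
      (PadicInt.toZModPow (n.factorization p)).comp (Pi.evalRingHom (fun p : n.primeFactors => ℤ_[p]) p)) x = m := by
    funext p
    exact h p
  change (ZMod.equivPi n (NeZero.ne n)).symm _ = _
  rw [this, map_intCast]

/-- The projection to the `p`-adic numbers. -/
noncomputable def padicProj (p : n.primeFactors) : (∀ p : n.primeFactors, ℤ_[p]) →+* ℚ_[p] :=
  PadicInt.Coe.ringHom.comp (Pi.evalRingHom _ p)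

theorem ext_padicProj {x y : ∀ p : n.primeFactors, ℤ_[p]}
    (h : ∀ p : n.primeFactors, padicProj p x = padicProj p y) : x = y := by
  funext p
  exact PadicInt.ext (h p)

theorem isPrimitive_of_isUnit {R : Type*} [CommRing R] {w : Fin 3 → R} (i : Fin 3)
    (h : IsUnit (w i)) : IsPrimitive w := by
  obtain ⟨u, hu⟩ := h.exists_left_inv
  refine ⟨Pi.single i u, ?_⟩
  fin_cases i <;> simpa using hu

theorem exists_primitive {p : ℕ} [Fact p.Prime] {v : Fin 3 → ℚ_[p]} (hv : v ≠ 0) :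
    ∃ w : Fin 3 → ℤ_[p], IsPrimitive w ∧ ∃ c : ℚ_[p], c ≠ 0 ∧ PadicInt.Coe.ringHom ∘ w = c • v := by
  obtain ⟨j, hj⟩ := Finite.exists_max fun i => ‖v i‖
  have hj0 : v j ≠ 0 := fun h => hv <| by
    ext i
    have := hj i
    rw [h, norm_zero] at this
    simpa using this
  have hle i : ‖(v j)⁻¹ * v i‖ ≤ 1 := by
    rw [norm_mul, norm_inv]
    exact inv_mul_le_one_of_le₀ (hj i) (norm_nonneg _)
  refine ⟨fun i => ⟨(v j)⁻¹ * v i, hle i⟩, isPrimitive_of_isUnit j ?_, (v j)⁻¹, inv_ne_zero hj0, rfl⟩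
  have h1 : (Subtype.mk ((v j)⁻¹ * v j) (hle j) : ℤ_[p]) = (1 : ℤ_[p]) :=
    PadicInt.ext (inv_mul_cancel₀ hj0)
  exact isUnit_iff_exists_inv.mpr ⟨1, (mul_one _).trans h1⟩

variable (W : WeierstrassCurve ℤ)

theorem map_int {R S : Type*} [CommRing R] [CommRing S] (f : R →+* S) :
    (W.map (Int.castRingHom R)).map f = W.map (Int.castRingHom S) := by
  rw [WeierstrassCurve.map_map]
  congr 1
  exact RingHom.ext_int _ _

theorem exists_coord_of_family (g : ∀ p : n.primeFactors,
      (W.map (Int.castRingHom ℚ_[p])).toProjective.Point) :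
    ∃ v : Fin 3 → ∀ p : n.primeFactors, ℤ_[p],
      IsCoord (W.map (Int.castRingHom _)) v ∧ ∀ p, ⟦padicProj p ∘ v⟧ = (g p).point := by
  have key (p : n.primeFactors) : ∃ w : Fin 3 → ℤ_[p], IsCoord (W.map (Int.castRingHom _)) w ∧
      ⟦PadicInt.Coe.ringHom ∘ w⟧ = (g p).point := by
    obtain ⟨u, hu⟩ := Quotient.exists_rep (g p).point
    have hns : (W.map (Int.castRingHom ℚ_[p])).toProjective.Nonsingular u := by
      have := (g p).nonsingular
      rwa [← hu] at this
    obtain ⟨w, hw, c, hc, hcw⟩ := exists_primitive (ne_zero_of_nonsingular _ hns)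
    refine ⟨w, ⟨hw, ?_⟩, ?_⟩
    · rw [← map_equation (f := PadicInt.Coe.ringHom) _ (fun a b h => PadicInt.ext h), hcw,
        equation_smul _ hc.isUnit]
      have := map_int W (PadicInt.Coe.ringHom (p := p))
      have h3 := hns.1
      rw [← this] at h3
      exact h3
    · rw [hcw, smul_eq _ hc.isUnit, hu]
  choose w hw hwg using key
  choose c hc using fun p => (hw p).1
  refine ⟨fun i p => w p i, ⟨⟨fun i p => c p i, funext hc⟩, ?_⟩, hwg⟩
  rw [equation_iff]
  funext p
  have := (equation_iff _).mp (hw p).2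
  simpa using this

theorem isSumCoord_of_family (g h : ∀ p : n.primeFactors,
      (W.map (Int.castRingHom ℚ_[p])).toProjective.Point)
    {v w s : Fin 3 → ∀ p : n.primeFactors, ℤ_[p]}
    (hv : ∀ p, ⟦padicProj p ∘ v⟧ = (g p).point) (hw : ∀ p, ⟦padicProj p ∘ w⟧ = (h p).point)
    (hs : ∀ p, ⟦padicProj p ∘ s⟧ = (g p + h p).point) :
    IsSumCoord (W.map (Int.castRingHom _)) v w s := by
  have key (p : n.primeFactors) :
      IsSumCoord ((W.map (Int.castRingHom (∀ p : n.primeFactors, ℤ_[p]))).map (padicProj p))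
        (padicProj p ∘ v) (padicProj p ∘ w) (padicProj p ∘ s) := by
    rw [map_int]
    have h1 := (g p).nonsingular
    have h2 := (h p).nonsingular
    have h3 := hs p
    rw [Point.add_point, ← hv p, ← hw p] at h3
    rw [← hv p] at h1
    rw [← hw p] at h2
    have h4 := Setoid.symm (Quotient.exact h3)
    have h5 := parallel_add _ h1 h2
    exact ⟨h5.1.of_equiv (Setoid.refl _) h4, h5.2.of_equiv (Setoid.refl _) h4⟩
  constructor
  · intro i j
    refine ext_padicProj fun p => ?_
    have := (key p).1 i j
    rw [map_addXYZ] at this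
    simpa using this
  · intro i j
    refine ext_padicProj fun p => ?_
    have := (key p).2 i j
    rw [altXYZ_map] at this
    simpa using this

theorem hensel_cubic {p : ℕ} [Fact p.Prime] {k : ℕ} (hk : k ≠ 0) {c₃ c₂ c₁ c₀ a : ℤ_[p]}
    (hd : ‖3 * c₃ * a ^ 2 + 2 * c₂ * a + c₁‖ = 1)
    (h : PadicInt.toZModPow k (c₃ * a ^ 3 + c₂ * a ^ 2 + c₁ * a + c₀) = 0) :
    ∃ z : ℤ_[p], c₃ * z ^ 3 + c₂ * z ^ 2 + c₁ * z + c₀ = 0 ∧ ‖z - a‖ < 1 ∧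
      PadicInt.toZModPow k z = PadicInt.toZModPow k a := by
  open Polynomial in
  let f : ℤ_[p][X] := C c₃ * X ^ 3 + C c₂ * X ^ 2 + C c₁ * X + C c₀
  have hf (t : ℤ_[p]) : Polynomial.aeval t f = c₃ * t ^ 3 + c₂ * t ^ 2 + c₁ * t + c₀ := by
    simp [f]
  have hf' (t : ℤ_[p]) :
      Polynomial.aeval t f.derivative = 3 * c₃ * t ^ 2 + 2 * c₂ * t + c₁ := by
    simp [f]
    ring
  have hlt : ‖c₃ * a ^ 3 + c₂ * a ^ 2 + c₁ * a + c₀‖ < 1 := by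
    rw [PadicInt.norm_lt_one_iff_dvd]
    rw [← RingHom.mem_ker, PadicInt.ker_toZModPow, Ideal.mem_span_singleton] at h
    exact (dvd_pow_self _ hk).trans h
  obtain ⟨z, hz, hza, -, -⟩ := hensels_lemma (F := f) (a := a) (by
    rw [hf, hf', hd, one_pow]; exact hlt)
  rw [hf] at hz
  rw [hf', hd] at hza
  refine ⟨z, hz, hza, ?_⟩
  have hu : IsUnit (3 * c₃ * a ^ 2 + 2 * c₂ * a + c₁ + (z - a) * (c₃ * (z + 2 * a) + c₂)) := by
    have h1 : ‖(z - a) * (c₃ * (z + 2 * a) + c₂)‖ < 1 := by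
      rw [norm_mul]
      exact mul_lt_one_of_nonneg_of_lt_one_left (norm_nonneg _) hza (PadicInt.norm_le_one _)
    rw [PadicInt.isUnit_iff, PadicInt.norm_add_eq_max_of_ne (by rw [hd]; exact h1.ne'), hd]
    exact max_eq_left h1.le
  have heq : (z - a) * (3 * c₃ * a ^ 2 + 2 * c₂ * a + c₁ + (z - a) * (c₃ * (z + 2 * a) + c₂)) =
      -(c₃ * a ^ 3 + c₂ * a ^ 2 + c₁ * a + c₀) := by
    linear_combination hz
  have := congrArg (PadicInt.toZModPow k) heq
  rw [map_mul, map_neg, h, neg_zero, (hu.map (PadicInt.toZModPow k)).mul_left_eq_zero, map_sub,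
    sub_eq_zero] at this
  exact this

theorem norm_intCast_eq_one {p : ℕ} [Fact p.Prime] {d : ℤ} (h : (d : ZMod p) ≠ 0) :
    ‖(d : ℤ_[p])‖ = 1 := by
  refine le_antisymm (PadicInt.norm_le_one _) (not_lt.mp fun hlt => h ?_)
  rw [PadicInt.norm_int_lt_one_iff_dvd] at hlt
  exact (ZMod.intCast_zmod_eq_zero_iff_dvd d p).mpr hlt

theorem exists_lift_local {p : ℕ} [Fact p.Prime] {k : ℕ} (hk : k ≠ 0)
    [(W.map (Int.castRingHom (ZMod p))).IsElliptic] {m : Fin 3 → ℤ}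
    (h : (W.map (Int.castRingHom (ZMod (p ^ k)))).toProjective.Equation
      (Int.castRingHom (ZMod (p ^ k)) ∘ m))
    (h' : IsCoord (W.map (Int.castRingHom (ZMod p))) (Int.castRingHom (ZMod p) ∘ m)) :
    ∃ w : Fin 3 → ℤ_[p], IsCoord (W.map (Int.castRingHom ℤ_[p])) w ∧
      ∀ i, PadicInt.toZModPow k (w i) = m i := by
  have h0 : Int.castRingHom (ZMod p) ∘ m ≠ 0 := fun h0 => by
    obtain ⟨c, hc⟩ := h'.1
    rw [h0] at hc
    simp at hc
  have hns := nonsingular_of_ne_zero _ h'.2 h0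
  have hprim (w : Fin 3 → ℤ_[p]) (hw : ∀ i, ‖w i - m i‖ < 1) : IsPrimitive w := by
    obtain ⟨i, hi⟩ := Function.ne_iff.mp h0
    have h1 : ‖(m i : ℤ_[p])‖ = 1 := norm_intCast_eq_one hi
    have h2 : IsUnit (w i) := by
      rw [PadicInt.isUnit_iff, ← sub_add_cancel (w i) (m i),
        PadicInt.norm_add_eq_max_of_ne (by rw [h1]; exact (hw i).ne), h1]
      exact max_eq_right (hw i).le
    exact isPrimitive_of_isUnit i h2
  rw [nonsingular_iff] at hns
  rw [equation_iff] at h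
  simp only [Function.comp_apply, map_a₁, map_a₂, map_a₃, map_a₄, map_a₆, Int.coe_castRingHom]
    at hns h
  rcases hns.2 with hd | hd | hd
  · obtain ⟨z, hz, hz1, hz2⟩ := hensel_cubic (p := p) hk (c₃ := -1) (c₂ := -(W.a₂ * m 2 : ℤ))
      (c₁ := (W.a₁ * m 1 * m 2 - W.a₄ * m 2 ^ 2 : ℤ))
      (c₀ := (m 1 ^ 2 * m 2 + W.a₃ * m 1 * m 2 ^ 2 - W.a₆ * m 2 ^ 3 : ℤ)) (a := m 0)
      (by
        convert norm_intCast_eq_one (p := p) (d := W.a₁ * m 1 * m 2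
          - (3 * m 0 ^ 2 + 2 * W.a₂ * m 0 * m 2 + W.a₄ * m 2 ^ 2)) ?_ using 2
        · push_cast; ring
        · rw [← sub_ne_zero] at hd
          push_cast
          convert hd using 1
          ring)
      (by
        simp only [map_add, map_mul, map_neg, map_one, map_pow, map_intCast]
        push_cast
        linear_combination h)
    refine ⟨![z, m 1, m 2], ⟨hprim _ ?_, ?_⟩, ?_⟩
    · intro i; fin_cases i <;> simp [hz1]
    · rw [equation_iff]
      simp only [fin3_def_ext, map_a₁, map_a₂, map_a₃, map_a₄, map_a₆, Int.coe_castRingHom]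
      push_cast at hz
      linear_combination hz
    · intro i; fin_cases i <;> simp [hz2]
  · obtain ⟨z, hz, hz1, hz2⟩ := hensel_cubic (p := p) hk (c₃ := 0) (c₂ := (m 2 : ℤ))
      (c₁ := (W.a₁ * m 0 * m 2 + W.a₃ * m 2 ^ 2 : ℤ))
      (c₀ := -(m 0 ^ 3 + W.a₂ * m 0 ^ 2 * m 2 + W.a₄ * m 0 * m 2 ^ 2 + W.a₆ * m 2 ^ 3 : ℤ))
      (a := m 1)
      (by
        convert norm_intCast_eq_one (p := p) (d := 2 * m 1 * m 2 + W.a₁ * m 0 * m 2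
          + W.a₃ * m 2 ^ 2) ?_ using 2
        · push_cast; ring
        · push_cast
          convert hd using 1)
      (by
        simp only [map_add, map_mul, map_neg, map_zero, map_pow, map_intCast]
        push_cast
        linear_combination h)
    refine ⟨![m 0, z, m 2], ⟨hprim _ ?_, ?_⟩, ?_⟩
    · intro i; fin_cases i <;> simp [hz1]
    · rw [equation_iff]
      simp only [fin3_def_ext, map_a₁, map_a₂, map_a₃, map_a₄, map_a₆, Int.coe_castRingHom]
      push_cast at hz
      linear_combination hz
    · intro i; fin_cases i <;> simp [hz2]
  · obtain ⟨z, hz, hz1, hz2⟩ := hensel_cubic (p := p) hk (c₃ := -(W.a₆ : ℤ))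
      (c₂ := (W.a₃ * m 1 - W.a₄ * m 0 : ℤ))
      (c₁ := (m 1 ^ 2 + W.a₁ * m 0 * m 1 - W.a₂ * m 0 ^ 2 : ℤ))
      (c₀ := -(m 0 ^ 3 : ℤ)) (a := m 2)
      (by
        convert norm_intCast_eq_one (p := p) (d := m 1 ^ 2 + W.a₁ * m 0 * m 1
          + 2 * W.a₃ * m 1 * m 2 - (W.a₂ * m 0 ^ 2 + 2 * W.a₄ * m 0 * m 2
          + 3 * W.a₆ * m 2 ^ 2)) ?_ using 2
        · push_cast; ring
        · rw [← sub_ne_zero] at hd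
          push_cast
          convert hd using 1
          ring)
      (by
        simp only [map_add, map_mul, map_neg, map_pow, map_intCast]
        push_cast
        linear_combination h)
    refine ⟨![m 0, m 1, z], ⟨hprim _ ?_, ?_⟩, ?_⟩
    · intro i; fin_cases i <;> simp [hz1]
    · rw [equation_iff]
      simp only [fin3_def_ext, map_a₁, map_a₂, map_a₃, map_a₄, map_a₆, Int.coe_castRingHom]
      push_cast at hz
      linear_combination hz
    · intro i; fin_cases i <;> simp [hz2]

theorem exists_lift [NeZero n] [(W.map (Int.castRingHom (ZMod n))).IsElliptic] {v : Fin 3 → ZMod n}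
    (hv : IsCoord (W.map (Int.castRingHom (ZMod n))) v) :
    ∃ w : Fin 3 → ∀ p : n.primeFactors, ℤ_[p],
      IsCoord (W.map (Int.castRingHom _)) w ∧ padicToZMod n ∘ w = v := by
  choose m hm using fun i => ZMod.intCast_surjective (v i)
  have hred {d : ℕ} (hd : d ∣ n) :
      IsCoord (W.map (Int.castRingHom (ZMod d))) (Int.castRingHom (ZMod d) ∘ m) := by
    have := hv.map (ZMod.castHom hd (ZMod d))
    rw [map_int] at this
    convert this using 1
    ext i
    simp [← hm]
  have key (p : n.primeFactors) : ∃ w : Fin 3 → ℤ_[p],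
      IsCoord (W.map (Int.castRingHom ℤ_[p])) w ∧
      ∀ i, PadicInt.toZModPow (n.factorization p) (w i) = m i := by
    have hpn := Nat.dvd_of_mem_primeFactors p.2
    have : (W.map (Int.castRingHom (ZMod p))).IsElliptic := by
      rw [← map_int W (ZMod.castHom hpn (ZMod p))]
      infer_instance
    have hk : n.factorization p ≠ 0 :=
      ((Nat.prime_of_mem_primeFactors p.2).factorization_pos_of_dvd (NeZero.ne n) hpn).ne'
    exact exists_lift_local W hk (hred (Nat.ordProj_dvd n p)).2 (hred hpn)
  choose w hw hwm using key
  choose c hc using fun p => (hw p).1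
  refine ⟨fun i p => w p i, ⟨⟨fun i p => c p i, funext hc⟩, ?_⟩, ?_⟩
  · rw [equation_iff]
    funext p
    have := (equation_iff _).mp (hw p).2
    simpa using this
  · ext i
    rw [← hm i]
    exact padicToZMod_eq fun p => hwm p i

/-- `v` is a common lift of the point `P` over `ℤ/nℤ` and of the points `g p` over `ℚ_p`. -/
def IsLift [NeZero n] (g : ∀ p : n.primeFactors,
      (W.map (Int.castRingHom ℚ_[p])).toProjective.Point)
    (P : RPoint (W.map (Int.castRingHom (ZMod n)))) : Prop :=
  ∃ v : Fin 3 → ∀ p : n.primeFactors, ℤ_[p], IsCoord (W.map (Int.castRingHom _)) v ∧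
    (∀ p, ⟦padicProj p ∘ v⟧ = (g p).point) ∧ ⟦padicToZMod n ∘ v⟧ = P.1

variable {W}

theorem IsCoord.toZMod [NeZero n] {v : Fin 3 → ∀ p : n.primeFactors, ℤ_[p]}
    (hv : IsCoord (W.map (Int.castRingHom _)) v) :
    IsCoord (W.map (Int.castRingHom (ZMod n))) (padicToZMod n ∘ v) := by
  have := hv.map (padicToZMod n)
  rwa [map_int] at this

theorem IsLift.unique [NeZero n] {g : ∀ p : n.primeFactors,
      (W.map (Int.castRingHom ℚ_[p])).toProjective.Point}
    {P Q : RPoint (W.map (Int.castRingHom (ZMod n)))} (hP : IsLift W g P) (hQ : IsLift W g Q) :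
    P = Q := by
  obtain ⟨v, hv, hvg, hvP⟩ := hP
  obtain ⟨w, hw, hwg, hwQ⟩ := hQ
  refine Subtype.ext (hvP.symm.trans ((Quotient.sound ?_).trans hwQ))
  have key : Parallel v w := fun i j => ext_padicProj fun p => by
    have := (parallel_refl (padicProj p ∘ v)).of_equiv (Setoid.refl _)
      (Quotient.exact ((hvg p).trans (hwg p).symm)) i j
    simpa using this
  exact equiv_of_parallel (hv.1.map _) (hw.1.map _) (key.map _)

theorem IsLift.add [NeZero n] [(W.map (Int.castRingHom (ZMod n))).IsElliptic]
    {g h : ∀ p : n.primeFactors, (W.map (Int.castRingHom ℚ_[p])).toProjective.Point}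
    {P Q : RPoint (W.map (Int.castRingHom (ZMod n)))} (hP : IsLift W g P) (hQ : IsLift W h Q) :
    IsLift W (fun p => g p + h p) (P + Q) := by
  obtain ⟨v, hv, hvg, hvP⟩ := hP
  obtain ⟨w, hw, hwh, hwQ⟩ := hQ
  obtain ⟨s, hs, hsg⟩ := exists_coord_of_family W fun p => g p + h p
  have hsum := (isSumCoord_of_family W g h hvg hwh hsg).map (padicToZMod n)
  rw [map_int] at hsum
  refine ⟨s, hs, hsg, ?_⟩
  have hP' : P = RPoint.mk (padicToZMod n ∘ v) hv.toZMod := Subtype.ext hvP.symm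
  have hQ' : Q = RPoint.mk (padicToZMod n ∘ w) hw.toZMod := Subtype.ext hwQ.symm
  rw [hP', hQ', mk_add_mk hv.toZMod hw.toZMod hs.toZMod hsum]
  rfl

theorem isLift_zero [NeZero n] : IsLift W (fun _ : n.primeFactors => 0) 0 := by
  refine ⟨![0, 1, 0], isCoord_zero _, fun p => ?_, ?_⟩
  · rw [comp_fin3, map_zero, map_one]
    rfl
  · rw [comp_fin3, map_zero, map_one]
    rfl

theorem IsLift.neg [NeZero n] {g : ∀ p : n.primeFactors,
      (W.map (Int.castRingHom ℚ_[p])).toProjective.Point}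
    {P : RPoint (W.map (Int.castRingHom (ZMod n)))} (hP : IsLift W g P) :
    IsLift W (fun p => -g p) (-P) := by
  obtain ⟨v, hv, hvg, hvP⟩ := hP
  refine ⟨_, hv.neg, fun p => ?_, ?_⟩
  · have h := Projective.map_neg (W' := W.map (Int.castRingHom _)) (padicProj p) v
    rw [← h, Point.neg_point, ← hvg p]
    have := map_int W (padicProj p)
    change (⟦((W.map (Int.castRingHom _)).map (padicProj p)).toProjective.neg _⟧ :
      PointClass _) = _
    rw [this]
    rfl
  · have h := Projective.map_neg (W' := W.map (Int.castRingHom _)) (padicToZMod n) v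
    rw [← h]
    change _ = (W.map (Int.castRingHom (ZMod n))).toProjective.negMap P.1
    rw [← hvP]
    have := map_int W (padicToZMod n)
    change (⟦((W.map (Int.castRingHom _)).map (padicToZMod n)).toProjective.neg _⟧ :
      PointClass _) = _
    rw [this]
    rfl

theorem exists_isLift [NeZero n] [(W.map (Int.castRingHom (ZMod n))).IsElliptic]
    (P : RPoint (W.map (Int.castRingHom (ZMod n)))) :
    ∃ g : ∀ p : n.primeFactors, (W.map (Int.castRingHom ℚ_[p])).toProjective.Point,
      IsLift W g P := by
  obtain ⟨u, hu, huP⟩ := P.2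
  obtain ⟨v, hv, rfl⟩ := exists_lift W hu
  have hns (p : n.primeFactors) :
      (W.map (Int.castRingHom ℚ_[p])).toProjective.Nonsingular (padicProj p ∘ v) := by
    have hpn := Nat.dvd_of_mem_primeFactors p.2
    have : (W.map (Int.castRingHom ℚ_[p])).IsElliptic := by
      refine ⟨IsUnit.mk0 _ fun h0 => ?_⟩
      rw [map_Δ, eq_intCast, Int.cast_eq_zero] at h0
      have h1 := ((W.map (Int.castRingHom (ZMod n))).isUnit_Δ).map (ZMod.castHom hpn (ZMod p))
      rw [map_Δ, h0, map_zero, map_zero] at h1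
      exact not_isUnit_zero h1
    have hv' := hv.map (padicProj p)
    rw [map_int] at hv'
    refine nonsingular_of_ne_zero _ hv'.2 fun h0 => ?_
    obtain ⟨c, hc⟩ := hv'.1
    rw [h0] at hc
    simp at hc
  exact ⟨fun p => ⟨(nonsingularLift_iff _).mpr (hns p)⟩, v, hv, fun p => rfl, huP⟩

end Lift

theorem exists_int_model {n : ℕ} (W : WeierstrassCurve (ZMod n)) :
    ∃ W₀ : WeierstrassCurve ℤ, W₀.map (Int.castRingHom (ZMod n)) = W := by
  obtain ⟨a₁, h₁⟩ := ZMod.intCast_surjective W.a₁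
  obtain ⟨a₂, h₂⟩ := ZMod.intCast_surjective W.a₂
  obtain ⟨a₃, h₃⟩ := ZMod.intCast_surjective W.a₃
  obtain ⟨a₄, h₄⟩ := ZMod.intCast_surjective W.a₄
  obtain ⟨a₆, h₆⟩ := ZMod.intCast_surjective W.a₆
  exact ⟨⟨a₁, a₂, a₃, a₄, a₆⟩, WeierstrassCurve.ext h₁ h₂ h₃ h₄ h₆⟩

/-- The group of points with values in `ℤ/nℤ` of an elliptic curve over `ℤ/nℤ`. -/
noncomputable instance {n : ℕ} [NeZero n] (W : WeierstrassCurve (ZMod n)) [W.IsElliptic] :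
    AddCommGroup (RPoint W) where
  add_assoc := by
    obtain ⟨W, rfl⟩ := exists_int_model W
    intro P Q S
    obtain ⟨g, hg⟩ := exists_isLift P
    obtain ⟨h, hh⟩ := exists_isLift Q
    obtain ⟨k, hk⟩ := exists_isLift S
    have h1 := (hg.add hh).add hk
    simp only [add_assoc] at h1
    exact h1.unique (hg.add (hh.add hk))
  zero_add := by
    obtain ⟨W, rfl⟩ := exists_int_model W
    intro P
    obtain ⟨g, hg⟩ := exists_isLift P
    have h1 := isLift_zero.add hg
    simp only [zero_add] at h1
    exact h1.unique hg
  add_zero := by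
    obtain ⟨W, rfl⟩ := exists_int_model W
    intro P
    obtain ⟨g, hg⟩ := exists_isLift P
    have h1 := hg.add isLift_zero
    simp only [add_zero] at h1
    exact h1.unique hg
  neg_add_cancel := by
    obtain ⟨W, rfl⟩ := exists_int_model W
    intro P
    obtain ⟨g, hg⟩ := exists_isLift P
    have h1 := hg.neg.add hg
    simp only [neg_add_cancel] at h1
    exact h1.unique isLift_zero
  add_comm := by
    obtain ⟨W, rfl⟩ := exists_int_model W
    intro P Q
    obtain ⟨g, hg⟩ := exists_isLift P
    obtain ⟨h, hh⟩ := exists_isLift Q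
    have h1 := hg.add hh
    simp only [add_comm (g _)] at h1
    exact h1.unique (hh.add hg)
  nsmul := nsmulRec
  zsmul := zsmulRec

/-! ### Elliptic curves over `ℚ` -/

/-- `W` is an integral Weierstrass equation for `E/ℚ`. -/
def IsIntegralModel (E : WeierstrassCurve ℚ) (W : WeierstrassCurve ℤ) : Prop :=
  ∃ C : VariableChange ℚ, W.map (Int.castRingHom ℚ) = C • E

/-- `W` is a (global) minimal Weierstrass equation for `E/ℚ`: an integral equation whose
discriminant is as small as possible in absolute value. -/
def IsMinimalModel (E : WeierstrassCurve ℚ) (W : WeierstrassCurve ℤ) : Prop :=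
  IsIntegralModel E W ∧ ∀ W', IsIntegralModel E W' → W.Δ.natAbs ≤ W'.Δ.natAbs

theorem exists_isIntegralModel (E : WeierstrassCurve ℚ) : ∃ W, IsIntegralModel E W := by
  let d : ℕ := E.a₁.den * E.a₂.den * E.a₃.den * E.a₄.den * E.a₆.den
  have hd : (d : ℚ) ≠ 0 := by simp [d]
  have key (a : ℚ) (h : a.den ∣ d) {i : ℕ} (hi : i ≠ 0) : ∃ z : ℤ, (z : ℚ) = (d : ℚ) ^ i * a := by
    obtain ⟨e, he⟩ := h.trans (dvd_pow_self d hi)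
    refine ⟨e * a.num, ?_⟩
    have h1 : (d : ℚ) ^ i = a.den * e := by exact_mod_cast he
    rw [h1]
    push_cast
    linear_combination -(e : ℚ) * a.den_mul_eq_num
  obtain ⟨b₁, h₁⟩ := key E.a₁ (by simp only [d, mul_assoc, dvd_mul_right]) one_ne_zero
  obtain ⟨b₂, h₂⟩ := key E.a₂ ⟨E.a₁.den * E.a₃.den * E.a₄.den * E.a₆.den, by simp only [d]; ring⟩
    two_ne_zero
  obtain ⟨b₃, h₃⟩ := key E.a₃ ⟨E.a₁.den * E.a₂.den * E.a₄.den * E.a₆.den, by simp only [d]; ring⟩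
    three_ne_zero
  obtain ⟨b₄, h₄⟩ := key E.a₄ ⟨E.a₁.den * E.a₂.den * E.a₃.den * E.a₆.den, by simp only [d]; ring⟩
    four_ne_zero
  obtain ⟨b₆, h₆⟩ := key E.a₆ ⟨E.a₁.den * E.a₂.den * E.a₃.den * E.a₄.den, by simp only [d]; ring⟩
    (i := 6) (by norm_num)
  refine ⟨⟨b₁, b₂, b₃, b₄, b₆⟩, ⟨(Units.mk0 (d : ℚ) hd)⁻¹, 0, 0, 0⟩, ?_⟩
  ext
  · simp [variableChange_a₁, h₁]
  · simp [variableChange_a₂, h₂]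
  · simp [variableChange_a₃, h₃]
  · simp [variableChange_a₄, h₄]
  · simp [variableChange_a₆, h₆]

theorem exists_isMinimalModel (E : WeierstrassCurve ℚ) : ∃ W, IsMinimalModel E W := by
  obtain ⟨W, hW, h⟩ := exists_minimalFor_of_wellFoundedLT (IsIntegralModel E)
    (fun W => W.Δ.natAbs) (exists_isIntegralModel E)
  exact ⟨W, hW, fun W' hW' => (le_total _ _).elim id fun h' => h hW' h'⟩

/-- A minimal Weierstrass equation for `E/ℚ`. -/
noncomputable def minimalModel (E : WeierstrassCurve ℚ) : WeierstrassCurve ℤ :=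
  (exists_isMinimalModel E).choose

/-- The reduction modulo `n` of the minimal Weierstrass equation of `E/ℚ`. -/
noncomputable abbrev reductionMod (E : WeierstrassCurve ℚ) (n : ℕ) : WeierstrassCurve (ZMod n) :=
  (minimalModel E).map (Int.castRingHom (ZMod n))

/-- `E/ℚ` has good reduction at `p`: the minimal Weierstrass equation defines an elliptic curve
modulo `p`. -/
def HasGoodReductionAt (E : WeierstrassCurve ℚ) (p : ℕ) : Prop :=
  (reductionMod E p).IsElliptic

theorem isElliptic_reductionMod {E : WeierstrassCurve ℚ} {n : ℕ}
    (h : ∀ p : ℕ, p.Prime → p ∣ n → HasGoodReductionAt E p) : (reductionMod E n).IsElliptic := by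
  constructor
  rw [map_Δ, eq_intCast, ZMod.coe_int_isUnit_iff_isCoprime, Int.isCoprime_iff_gcd_eq_one]
  refine Nat.coprime_of_dvd fun p hp hpn hpΔ => ?_
  have hu := (h p hp (by simpa using hpn)).isUnit
  have : Fact p.Prime := ⟨hp⟩
  rw [map_Δ, eq_intCast, (ZMod.intCast_zmod_eq_zero_iff_dvd _ p).mpr
    (Int.natCast_dvd.mpr hpΔ)] at hu
  exact not_isUnit_zero hu

/-- The group `E(ℤ/nℤ)`. -/
abbrev PointsMod (E : WeierstrassCurve ℚ) (n : ℕ) : Type :=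
  RPoint (reductionMod E n)

theorem neZero_of_two_le {n : ℕ} (h : 2 ≤ n.primeFactors.card) : NeZero n :=
  ⟨by rintro rfl; simp at h⟩

/-- `n` is an elliptic pseudoprime for `(E, P)`, where `P ∈ E(ℤ/nℤ)`.  Here `E.LFunction n` is the
coefficient `a_n` of the `L`-series of `E/ℚ`. -/
structure IsEllipticPseudoprime (E : WeierstrassCurve ℚ) (n : ℕ) (P : PointsMod E n) : Prop where
  two_le_card : 2 ≤ n.primeFactors.card
  good : ∀ p : ℕ, p.Prime → p ∣ n → HasGoodReductionAt E p
  smul_eq_zero :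
    haveI := neZero_of_two_le two_le_card
    haveI := isElliptic_reductionMod good
    ((n : ℤ) + 1 - E.LFunction n) • P = 0

/-- `n` is an elliptic Carmichael number for `E`. -/
def IsEllipticCarmichael (E : WeierstrassCurve ℚ) (n : ℕ) : Prop :=
  ∀ P : PointsMod E n, IsEllipticPseudoprime E n P

theorem isElliptic_reductionMod_pow {E : WeierstrassCurve ℚ} {p : ℕ} (hp : p.Prime)
    (h : HasGoodReductionAt E p) (k : ℕ) : (reductionMod E (p ^ k)).IsElliptic :=
  isElliptic_reductionMod fun _ hq hqp =>
    (Nat.prime_dvd_prime_iff_eq hq hp).mp (hq.dvd_of_dvd_pow hqp) ▸ h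

/-- The exponent `e_{n,p}(E)` of the group `E(ℤ/p^{ord_p(n)}ℤ)`, for a prime `p` of good reduction. -/
noncomputable def localExponent (E : WeierstrassCurve ℚ) (n : ℕ) {p : ℕ} (hp : p.Prime)
    (h : HasGoodReductionAt E p) : ℕ :=
  haveI : NeZero (p ^ n.factorization p) := ⟨pow_ne_zero _ hp.ne_zero⟩
  haveI := isElliptic_reductionMod_pow hp h (n.factorization p)
  AddMonoid.exponent (PointsMod E (p ^ n.factorization p))

/-- `n` is an elliptic Korselt number for `E` of Type II. -/
structure IsEllipticKorseltII (E : WeierstrassCurve ℚ) (n : ℕ) : Prop where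
  two_le_card : 2 ≤ n.primeFactors.card
  good : ∀ p : ℕ, p.Prime → p ∣ n → HasGoodReductionAt E p
  exponent_dvd : ∀ (p : ℕ) (hp : p.Prime) (hpn : p ∣ n),
    (localExponent E n hp (good p hp hpn) : ℤ) ∣ (n : ℤ) + 1 - E.LFunction n

end EllKorselt

/-!
The relation `P + Q = S` on points is given by polynomial identities in primitive coordinate
vectors, so every ring homomorphism preserves it.  Being primitive, satisfying the Weierstrass
equation and being parallel are also expressed by identities, and an identity in a product of rings
can be checked in each factor.  The Chinese remainder theorem therefore identifies `E(ℤ/nℤ)` with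
the product of the groups `E(ℤ/p^kℤ)`, and the exponent of a product is the least common multiple
of the exponents of its factors.
-/

namespace EllKorselt

open WeierstrassCurve.Projective

section Map

variable {R S : Type*} [CommRing R] [CommRing S]

theorem RPoint.exists_mk_eq {W : WeierstrassCurve R} (P : RPoint W) :
    ∃ v, ∃ hv : IsCoord W v, mk v hv = P := by
  obtain ⟨_, v, hv, rfl⟩ := P
  exact ⟨v, hv, rfl⟩

theorem RPoint.mk_eq_mk_iff {W : WeierstrassCurve R} {v w : Fin 3 → R} (hv : IsCoord W v)
    (hw : IsCoord W w) : mk v hv = mk w hw ↔ Parallel v w where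
  mp h := (parallel_refl v).of_equiv (Setoid.refl _) (Quotient.exact (congrArg Subtype.val h))
  mpr h := Subtype.ext (Quotient.sound (equiv_of_parallel hv.1 hw.1 h))

/-- The map on points induced by a ring homomorphism `f`.  The image curve is a variable `W'` with
a proof of `W.map f = W'`, since the base changes to `ℤ/dℤ` of an integral model `W`, directly
or through `ℤ/nℤ`, are not definitionally equal. -/
def RPoint.map {W : WeierstrassCurve R} {W' : WeierstrassCurve S} (f : R →+* S) (hf : W.map f = W')
    (P : RPoint W) : RPoint W' where
  val := Quotient.map (f ∘ ·)
    (by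
      rintro _ w ⟨a, rfl⟩
      exact ⟨Units.map f a, by ext i; simp [Units.smul_def]⟩) P.1
  property := by
    obtain ⟨v, hv, h⟩ := P.2
    exact ⟨f ∘ v, hf ▸ hv.map f, by rw [← h]; rfl⟩

theorem RPoint.map_mk {W : WeierstrassCurve R} {W' : WeierstrassCurve S} (f : R →+* S)
    (hf : W.map f = W') {v : Fin 3 → R} (hv : IsCoord W v) :
    map f hf (mk v hv) = mk (f ∘ v) (hf ▸ hv.map f) :=
  rfl

end Map

section Sum

variable {R S : Type*} [CommRing R] [CommRing S] {W : WeierstrassCurve R} {W' : WeierstrassCurve S}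

theorem IsSum.map (f : R →+* S) (hf : W.map f = W') {P Q T : RPoint W} (h : IsSum P Q T) :
    IsSum (P.map f hf) (Q.map f hf) (T.map f hf) := by
  obtain ⟨⟨_, _⟩, ⟨_, _⟩, ⟨_, _⟩⟩ := P, Q, T
  obtain ⟨v, w, s, rfl, rfl, rfl, h⟩ := h
  exact ⟨f ∘ v, f ∘ w, f ∘ s, rfl, rfl, rfl, hf ▸ h.map f⟩

theorem IsSum.add_eq [W.IsElliptic] {P Q T : RPoint W} (h : IsSum P Q T) : P + Q = T := by
  obtain ⟨v, hv, rfl⟩ := P.exists_mk_eq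
  obtain ⟨w, hw, rfl⟩ := Q.exists_mk_eq
  obtain ⟨s, hs, rfl⟩ := T.exists_mk_eq
  obtain ⟨v', w', s', hvv', hww', hss', h⟩ := h
  exact mk_add_mk hv hw hs
    (h.of_equiv (Quotient.exact hvv') (Quotient.exact hww') (Quotient.exact hss'))

attribute [local instance] fact_prime_of_mem

/-- Addition of points has the junk value `0` where no sum exists.  Lifting to `ℤ_[p]` for every
prime `p ∣ n`, and thus to the group of points over `ℚ_[p]`, shows that over `ℤ/nℤ` this never
happens. -/
theorem isSum_add {n : ℕ} [NeZero n] {W : WeierstrassCurve (ZMod n)} [W.IsElliptic]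
    (P Q : RPoint W) : IsSum P Q (P + Q) := by
  obtain ⟨W, rfl⟩ := exists_int_model W
  obtain ⟨g, hP⟩ := exists_isLift P
  obtain ⟨h, hQ⟩ := exists_isLift Q
  obtain ⟨s, -, hsg, hs⟩ := hP.add hQ
  obtain ⟨v, -, hvg, hv⟩ := hP
  obtain ⟨w, -, hwh, hw⟩ := hQ
  have hsum := (isSumCoord_of_family W g h hvg hwh hsg).map (padicToZMod n)
  rw [map_int] at hsum
  exact ⟨_, _, _, hv, hw, hs, hsum⟩

end Sum

theorem RPoint.map_add {n : ℕ} [NeZero n] {S : Type*} [CommRing S] {W : WeierstrassCurve (ZMod n)}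
    [W.IsElliptic] {W' : WeierstrassCurve S} (f : ZMod n →+* S) (hf : W.map f = W')
    (P Q : RPoint W) : map f hf (P + Q) = map f hf P + map f hf Q := by
  have : W'.IsElliptic := hf ▸ inferInstance
  exact ((isSum_add P Q).map f hf).add_eq.symm

section Pi

variable {ι R : Type*} {S : ι → Type*} [CommRing R] [∀ i, CommRing (S i)]
  {W : WeierstrassCurve R} {W' : ∀ i, WeierstrassCurve (S i)} {f : ∀ i, R →+* S i}

theorem isCoord_of_forall_isCoord_comp (hf : Function.Bijective (RingHom.pi f))
    {v : Fin 3 → R} (hv : ∀ i, IsCoord (W.map (f i)) (f i ∘ v)) : IsCoord W v := by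
  choose c hc using fun i => (hv i).1
  choose d hd using fun j => hf.2 fun i => c i j
  refine ⟨⟨d, hf.1 (funext fun i => ?_)⟩, (equation_iff v).mpr (hf.1 (funext fun i => ?_))⟩
  · have hdc (j : Fin 3) : f i (d j) = c i j := congrFun (hd j) i
    simpa [hdc] using hc i
  · simpa using (equation_iff _).mp (hv i).2

theorem RPoint.map_pi_injective (hf : Function.Injective (RingHom.pi f))
    (hW : ∀ i, W.map (f i) = W' i) :
    Function.Injective fun (P : RPoint W) i => map (f i) (hW i) P := by
  intro P Q hPQ
  obtain ⟨v, hv, rfl⟩ := P.exists_mk_eq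
  obtain ⟨w, hw, rfl⟩ := Q.exists_mk_eq
  refine (mk_eq_mk_iff hv hw).mpr fun j k => hf (funext fun i => ?_)
  have hvw : Parallel (f i ∘ v) (f i ∘ w) :=
    (mk_eq_mk_iff (hW i ▸ hv.map _) (hW i ▸ hw.map _)).mp (congrFun hPQ i)
  simpa using hvw j k

theorem RPoint.map_pi_bijective (hf : Function.Bijective (RingHom.pi f))
    (hW : ∀ i, W.map (f i) = W' i) :
    Function.Bijective fun (P : RPoint W) i => map (f i) (hW i) P := by
  refine ⟨map_pi_injective hf.1 hW, fun Q => ?_⟩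
  choose w hw hwQ using fun i => (Q i).exists_mk_eq
  choose v hv using fun j => hf.2 fun i => w i j
  have hvw (i : ι) : f i ∘ v = w i := funext fun j => congrFun (hv j) i
  have hv' : IsCoord W v :=
    isCoord_of_forall_isCoord_comp hf fun i => by rw [hW i, hvw i]; exact hw i
  exact ⟨mk v hv', funext fun i => by simp only [map_mk, hvw, hwQ]⟩

end Pi

section PiZMod

variable {ι : Type*} {n : ℕ} {d : ι → ℕ} [NeZero n] [∀ i, NeZero (d i)]
  {W : WeierstrassCurve (ZMod n)} {W' : ∀ i, WeierstrassCurve (ZMod (d i))}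
  [W.IsElliptic] [∀ i, (W' i).IsElliptic] {f : ∀ i, ZMod n →+* ZMod (d i)}

/-- The Chinese remainder isomorphism for points: a decomposition of `ℤ/nℤ` as the product of the
rings `ℤ/dᵢℤ` decomposes the group of points accordingly. -/
noncomputable def RPoint.piEquiv (hf : Function.Bijective (RingHom.pi f))
    (hW : ∀ i, W.map (f i) = W' i) : RPoint W ≃+ ∀ i, RPoint (W' i) where
  __ := Equiv.ofBijective _ (map_pi_bijective hf hW)
  map_add' P Q := funext fun i => map_add (f i) (hW i) P Q

theorem RPoint.exponent_eq_lcm [Fintype ι] (hf : Function.Bijective (RingHom.pi f))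
    (hW : ∀ i, W.map (f i) = W' i) :
    AddMonoid.exponent (RPoint W) =
      Finset.univ.lcm fun i => AddMonoid.exponent (RPoint (W' i)) :=
  (AddMonoid.exponent_eq_of_addEquiv (piEquiv hf hW)).trans AddMonoid.exponent_pi

end PiZMod

theorem bijective_pi_castHom_primeFactors (n : ℕ) [NeZero n] :
    Function.Bijective (RingHom.pi fun p : n.primeFactors =>
      ZMod.castHom (Nat.ordProj_dvd n p) (ZMod (p ^ n.factorization p))) := by
  rw [Subsingleton.elim (RingHom.pi _) (ZMod.equivPi n (NeZero.ne n)).toRingHom]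
  exact (ZMod.equivPi n (NeZero.ne n)).bijective

section PointsMod

variable {E : WeierstrassCurve ℚ} {n : ℕ} [NeZero n]

theorem exponent_pointsMod_eq_lcm
    (good : ∀ p : ℕ, p.Prime → p ∣ n → HasGoodReductionAt E p) :
    haveI := isElliptic_reductionMod good
    AddMonoid.exponent (PointsMod E n) = Finset.univ.lcm fun p : n.primeFactors =>
      localExponent E n (Nat.prime_of_mem_primeFactors p.2)
        (good p (Nat.prime_of_mem_primeFactors p.2) (Nat.dvd_of_mem_primeFactors p.2)) := by
  have := isElliptic_reductionMod good
  have hp (p : n.primeFactors) : (p : ℕ).Prime := Nat.prime_of_mem_primeFactors p.2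
  have (p : n.primeFactors) : NeZero ((p : ℕ) ^ n.factorization p) :=
    ⟨pow_ne_zero _ (hp p).ne_zero⟩
  have (p : n.primeFactors) : (reductionMod E (p ^ n.factorization p)).IsElliptic :=
    isElliptic_reductionMod_pow (hp p) (good p (hp p) (Nat.dvd_of_mem_primeFactors p.2)) _
  exact RPoint.exponent_eq_lcm (bijective_pi_castHom_primeFactors n)
    fun _ => map_int (minimalModel E) _

theorem forall_zsmul_eq_zero_iff_localExponent_dvd
    (good : ∀ p : ℕ, p.Prime → p ∣ n → HasGoodReductionAt E p) (N : ℤ) :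
    haveI := isElliptic_reductionMod good
    (∀ P : PointsMod E n, N • P = 0) ↔
      ∀ (p : ℕ) (hp : p.Prime) (hpn : p ∣ n), (localExponent E n hp (good p hp hpn) : ℤ) ∣ N := by
  have := isElliptic_reductionMod good
  rw [← AddGroup.exponent_dvd_iff_forall_zsmul_eq_zero, exponent_pointsMod_eq_lcm good]
  simp only [Int.natCast_dvd, Finset.lcm_dvd_iff, Finset.mem_univ, forall_const, Subtype.forall,
    Nat.mem_primeFactors_of_ne_zero (NeZero.ne n)]
  exact ⟨fun h p hp hpn => h p ⟨hp, hpn⟩, fun h p hp => h p hp.1 hp.2⟩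

end PointsMod

end EllKorselt

theorem mainTheorem2_general (E : WeierstrassCurve ℚ) (n : ℕ) :
    EllKorselt.IsEllipticCarmichael E n ↔ EllKorselt.IsEllipticKorseltII E n := by
  refine ⟨fun h => ?_, fun h P => ?_⟩
  · obtain ⟨two_le, good, -⟩ := h 0
    have := EllKorselt.neZero_of_two_le two_le
    exact ⟨two_le, good, (EllKorselt.forall_zsmul_eq_zero_iff_localExponent_dvd good _).mp
      fun P => (h P).smul_eq_zero⟩
  · have := EllKorselt.neZero_of_two_le h.two_le_card
    exact ⟨h.two_le_card, h.good,
      (EllKorselt.forall_zsmul_eq_zero_iff_localExponent_dvd h.good _).mpr h.exponent_dvd P⟩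

theorem mainTheorem2 (E : WeierstrassCurve ℚ) [E.IsElliptic] (n : ℕ) (hn : 2 < n) (hodd : Odd n) :
    EllKorselt.IsEllipticCarmichael E n ↔ EllKorselt.IsEllipticKorseltII E n :=
  mainTheorem2_general E n
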